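/- Let $\varepsilon>0$ and let $p>2$ be a prime. For integers $n\ge 0$ and $\alpha_1,\alpha_2,\alpha_3$, put $q:=p^n$ and let $m(\alpha_1,\alpha_2,\alpha_3;q)$ be the smallest value of $\max\{|x_1|,|x_2|,|x_3|\}$ over all $(x_1,x_2,x_3)\in\mathbb{Z}^3$ with $$\alpha_1x_1^2+\alpha_2x_2^2+\alpha_3x_3^2\equiv 0 \bmod q \quad\text{and}\quad p\nmid x_1x_2x_3;$$ if there is no such $(x_1,x_2,x_3)$, put $m(\alpha_1,\alpha_2,\alpha_3;q):=0$. Then the following hold. (i) If $\alpha_1,\alpha_2,\alpha_3$ are fixed integers with $(\alpha_1\alpha_2\alpha_3,p)=1$, then there is a constant $C>0$, depending only on $p$, $\alpha_1,\alpha_2,\alpha_3$ and $\varepsilon$, such that for all $n\ge 0$ $$m(\alpha_1,\alpha_2,\alpha_3;q)\le C\,q^{1/2+\varepsilon}.$$ (ii) There is a constant $C>0$, depending only on $p$ and $\varepsilon$, such that for all $n\ge 0$ and all integers $\alpha_1,\alpha_2,\alpha_3$ with $(\alpha_1\alpha_2\alpha_3,p)=1$ $$m(\alpha_1,\alpha_2,\alpha_3;q)\le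 C\,q^{11/18+\varepsilon}.$$ (For $n\ge1$ the left-hand side depends only on the residues of the $\alpha_i$ modulo $q$, so this bounds the maximum over all triples of residue classes modulo $q$ coprime to $p$.) -/

import Mathlib

/-- The set of heights `max {|x₁|, |x₂|, |x₃|}` of the integer solutions of
`α₁ x₁² + α₂ x₂² + α₃ x₃² ≡ 0 mod p ^ n` with `p ∤ x₁ x₂ x₃`. -/
def solutionHeights (p n : ℕ) (α₁ α₂ α₃ : ℤ) : Set ℕ :=
  {M : ℕ | ∃ x₁ x₂ x₃ : ℤ,
    α₁ * x₁ ^ 2 + α₂ * x₂ ^ 2 + α₃ * x₃ ^ 2 ≡ 0 [ZMOD (p : ℤ) ^ n] ∧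
    ¬ (p : ℤ) ∣ x₁ * x₂ * x₃ ∧
    M = max x₁.natAbs (max x₂.natAbs x₃.natAbs)}

/-- `m(α₁, α₂, α₃; p ^ n)`: the smallest height of a solution; it is `0` if there is no solution,
because the infimum of the empty set of natural numbers is `0`. -/
noncomputable def minHeight (p n : ℕ) (α₁ α₂ α₃ : ℤ) : ℕ :=
  sInf (solutionHeights p n α₁ α₂ α₃)

/-- If there is a solution, the infimum is attained by one. -/
theorem minHeight_mem {p n : ℕ} {α₁ α₂ α₃ : ℤ} (h : (solutionHeights p n α₁ α₂ α₃).Nonempty) :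
    minHeight p n α₁ α₂ α₃ ∈ solutionHeights p n α₁ α₂ α₃ :=
  Nat.sInf_mem h

/-- If there is no solution, the value is `0`. -/
theorem minHeight_eq_zero {p n : ℕ} {α₁ α₂ α₃ : ℤ} (h : solutionHeights p n α₁ α₂ α₃ = ∅) :
    minHeight p n α₁ α₂ α₃ = 0 := by
  rw [minHeight, h, Nat.sInf_empty]

open Matrix

/-! A solution prime to `p` scales to `(1, e, f)` modulo `q`, so modulo `q` the form is `Q = -(b e²
+ c f²) x² + b y² + c z²`, with the integral zero `(1, e, f)`. Parametrize the conic `Q = 0` by `t`;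
pairing `v` with the point at `t` gives a quadratic polynomial `P_v` whose discriminant is `Q(v)` up
to a factor prime to `p` (`slope_sq_sub`). So `p ^ (2k)` divides `Q(v)` on `lattice p t k`, of index
at most `p ^ (3k)`. If it has no unusually short vector, it has three independent vectors of height
`≪ p ^ k`, about `q ^ (1/2)`.

Such a `t` is found by descending a tree in which each vertex has `p` children. Short vectors in two
children of a good vertex have cross product `p ^ k` times a very short vector of the dual lattice,
hence zero; being parallel, they belong to the same child. So at most one child is bad for the
lattice and one for its dual, and `p ≥ 3` leaves a child good for both (`exists_separated`).
Pigeonhole then gives independent vectors (`exists_independent`), and reduction by them a short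
vector proportional to `(1, e, f)` modulo `p` (`exists_short`, `not_dvd_apply`). The constant
depends on `p` only, and both exponents exceed `1/2`. -/

/-- Three integral linear forms on `ℤ³`, regarded as the coefficients of a binary quadratic
polynomial `lead · t² + 2 mid · t + const` attached to each vector. -/
structure QuadFrame where
  /-- the leading coefficient -/
  lead : Fin 3 → ℤ
  /-- half of the middle coefficient -/
  mid : Fin 3 → ℤ
  /-- the constant coefficient -/
  const : Fin 3 → ℤ

/-! ### Boxes and cross products. -/

/-- All coordinates of `v` are at most `H` in absolute value. -/
def InBox (H : ℤ) (v : Fin 3 → ℤ) : Prop := ∀ i, |v i| ≤ H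

theorem InBox.cross {H K : ℤ} {v w : Fin 3 → ℤ} (hv : InBox H v) (hw : InBox K w) :
    InBox (2 * (H * K)) (v ⨯₃ w) := by
  have key : ∀ i j : Fin 3, |v i * w j| ≤ H * K := fun i j => by
    rw [abs_mul]
    exact mul_le_mul (hv i) (hw j) (abs_nonneg _) ((abs_nonneg _).trans (hv i))
  have sub : ∀ i j : Fin 3, |v i * w j - v j * w i| ≤ 2 * (H * K) := fun i j => by
    have h1 := abs_le.1 (key i j)
    have h2 := abs_le.1 (key j i)
    exact abs_le.2 ⟨by linarith, by linarith⟩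
  intro i
  fin_cases i <;> simp only [cross_apply] <;> apply sub

theorem cross_eq_zero_apply {v w : Fin 3 → ℤ} (h : v ⨯₃ w = 0) (i j : Fin 3) :
    v i * w j = v j * w i := by
  have h0 := congrFun h 0
  have h1 := congrFun h 1
  have h2 := congrFun h 2
  simp [cross_apply] at h0 h1 h2
  fin_cases i <;> fin_cases j <;> simp <;> linarith

/-- A vector parallel to `w` has its largest coordinate where `w` has. -/
theorem abs_le_abs_of_cross_eq_zero {v w : Fin 3 → ℤ} (h : v ⨯₃ w = 0) (hw : w ≠ 0) {i : Fin 3}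
    (hi : ∀ j, |w j| ≤ |w i|) (j : Fin 3) : |v j| ≤ |v i| := by
  have hpos : 0 < |w i| := by
    obtain ⟨j, hj⟩ := Function.ne_iff.1 hw
    exact (abs_pos.2 hj).trans_le (hi j)
  have h1 := congrArg abs (cross_eq_zero_apply h j i)
  rw [abs_mul, abs_mul] at h1
  refine le_of_mul_le_mul_right ?_ hpos
  rw [h1]
  exact mul_le_mul_of_nonneg_left (hi j) (abs_nonneg _)

theorem exists_forall_abs_le (w : Fin 3 → ℤ) : ∃ i, ∀ j, |w j| ≤ |w i| := by
  obtain ⟨i, -, hi⟩ := Finset.exists_max_image Finset.univ (fun i => |w i|) ⟨0, Finset.mem_univ _⟩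
  exact ⟨i, fun j => hi j (Finset.mem_univ _)⟩

/-! ### Lattices attached to a frame, and their duality. -/

namespace QuadFrame

variable (F G : QuadFrame)

/-- The value at `t` of the polynomial attached to `v`. -/
def value (t : ℤ) (v : Fin 3 → ℤ) : ℤ := F.lead ⬝ᵥ v * t ^ 2 + 2 * (F.mid ⬝ᵥ v) * t + F.const ⬝ᵥ v

/-- Half of the derivative at `t` of the polynomial attached to `v`. -/
def slope (t : ℤ) (v : Fin 3 → ℤ) : ℤ := F.lead ⬝ᵥ v * t + F.mid ⬝ᵥ v

/-- The vectors whose polynomial `P` satisfies `P (t + p ^ k T) ≡ 0 mod p ^ (2 k)`. -/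
def lattice (p t : ℤ) (k : ℕ) : AddSubgroup (Fin 3 → ℤ) where
  carrier := {v | p ^ (2 * k) ∣ F.value t v ∧ p ^ k ∣ F.slope t v}
  zero_mem' := by simp [value, slope]
  add_mem' := by
    rintro v w ⟨h1, h2⟩ ⟨h3, h4⟩
    refine ⟨(dvd_add h1 h3).trans (dvd_of_eq ?_), (dvd_add h2 h4).trans (dvd_of_eq ?_)⟩ <;>
      simp only [value, slope, dotProduct_add] <;> ring
  neg_mem' := by
    rintro v ⟨h1, h2⟩
    refine ⟨(dvd_neg.2 h1).trans (dvd_of_eq ?_), (dvd_neg.2 h2).trans (dvd_of_eq ?_)⟩ <;>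
      simp only [value, slope, dotProduct_neg] <;> ring

variable {F G} {p t : ℤ} {k : ℕ} {v w : Fin 3 → ℤ}

theorem value_add (s : ℤ) :
    F.value (t + s) v = F.value t v + 2 * s * F.slope t v + s ^ 2 * (F.lead ⬝ᵥ v) := by
  simp only [value, slope]; ring

theorem slope_add (s : ℤ) : F.slope (t + s) v = F.slope t v + s * (F.lead ⬝ᵥ v) := by
  simp only [slope]; ring

theorem value_smul (c : ℤ) : F.value t (c • v) = c * F.value t v := by
  simp only [value, dotProduct_smul, smul_eq_mul]; ring

theorem slope_smul (c : ℤ) : F.slope t (c • v) = c * F.slope t v := by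
  simp only [slope, dotProduct_smul, smul_eq_mul]; ring

/-- The lattices at the children of a vertex are contained in the lattice of the vertex. -/
theorem lattice_child_le (s : ℤ) : F.lattice p (t + p ^ k * s) (k + 1) ≤ F.lattice p t k := by
  rintro v ⟨h1, h2⟩
  have h2' : p ^ k ∣ F.slope t v := by
    have h := (pow_dvd_pow p k.le_succ).trans h2
    rw [slope_add] at h
    exact (dvd_add_left (dvd_mul_of_dvd_left (dvd_mul_right _ _) _)).1 h
  refine ⟨?_, h2'⟩
  have h := (pow_dvd_pow p (show 2 * k ≤ 2 * (k + 1) by lia)).trans h1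
  rw [value_add, add_assoc] at h
  refine (dvd_add_left ?_).1 h
  obtain ⟨c, hc⟩ := h2'
  exact ⟨2 * s * c + s ^ 2 * (F.lead ⬝ᵥ v), by rw [hc]; ring⟩

/-- The frames `F` and `G` are exchanged by the cross product, up to the factor `κ`. -/
structure IsDual (F G : QuadFrame) (κ : ℤ) : Prop where
  lead_mid : F.lead ⨯₃ F.mid = -κ • G.lead
  lead_const : F.lead ⨯₃ F.const = -(2 * κ) • G.mid
  mid_const : F.mid ⨯₃ F.const = -κ • G.const

variable {κ : ℤ}

namespace IsDual

variable (h : F.IsDual G κ)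
include h

/-- By Binet–Cauchy, the 2×2 minors of the `F`-coordinates of `v`, `w` are, up to units, the
`G`-coordinates of `v ⨯₃ w`. -/
theorem lead_slope (v w : Fin 3 → ℤ) :
    F.lead ⬝ᵥ v * F.slope t w - F.lead ⬝ᵥ w * F.slope t v = -κ * (G.lead ⬝ᵥ v ⨯₃ w) := by
  have h1 := cross_dot_cross F.lead F.mid v w
  rw [h.lead_mid, smul_dotProduct, smul_eq_mul] at h1
  rw [h1]; simp only [slope]; ring

theorem lead_value (v w : Fin 3 → ℤ) :
    F.lead ⬝ᵥ v * F.value t w - F.lead ⬝ᵥ w * F.value t v = -(2 * κ) * G.slope t (v ⨯₃ w) := by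
  have h1 := cross_dot_cross F.lead F.mid v w
  have h2 := cross_dot_cross F.lead F.const v w
  rw [h.lead_mid, smul_dotProduct, smul_eq_mul] at h1
  rw [h.lead_const, smul_dotProduct, smul_eq_mul] at h2
  simp only [slope, value]; linear_combination -2 * t * h1 - h2

theorem slope_value (v w : Fin 3 → ℤ) :
    F.slope t v * F.value t w - F.slope t w * F.value t v = -κ * G.value t (v ⨯₃ w) := by
  have h1 := cross_dot_cross F.lead F.mid v w
  have h2 := cross_dot_cross F.lead F.const v w
  have h3 := cross_dot_cross F.mid F.const v w
  rw [h.lead_mid, smul_dotProduct, smul_eq_mul] at h1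
  rw [h.lead_const, smul_dotProduct, smul_eq_mul] at h2
  rw [h.mid_const, smul_dotProduct, smul_eq_mul] at h3
  simp only [slope, value]; linear_combination -t ^ 2 * h1 - t * h2 - h3

end IsDual

/-- The determinant of the three linear forms. -/
def det (F : QuadFrame) : ℤ := F.lead ⬝ᵥ F.mid ⨯₃ F.const

theorem det_mul_apply (i : Fin 3) :
    F.det * v i = F.lead ⬝ᵥ v * (F.mid ⨯₃ F.const) i - F.mid ⬝ᵥ v * (F.lead ⨯₃ F.const) i +
      F.const ⬝ᵥ v * (F.lead ⨯₃ F.mid) i := by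
  fin_cases i <;> simp [det, cross_apply, dotProduct, Fin.sum_univ_three] <;> ring

/-- Cramer's rule: `t` only shears the three coordinates, and the determinant is prime to `p`. -/
theorem pow_dvd_apply (hp : Prime p) (hdet : ¬ p ∣ F.det) {j : ℕ} (h1 : p ^ j ∣ F.lead ⬝ᵥ v)
    (h2 : p ^ j ∣ F.slope t v) (h3 : p ^ j ∣ F.value t v) (i : Fin 3) : p ^ j ∣ v i := by
  have h4 : p ^ j ∣ F.mid ⬝ᵥ v := by
    have := dvd_sub h2 (dvd_mul_of_dvd_left h1 t)
    rwa [slope, add_sub_cancel_left] at this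
  have h5 : p ^ j ∣ F.const ⬝ᵥ v := by
    have := dvd_sub h3 (dvd_add (dvd_mul_of_dvd_left h1 (t ^ 2)) (dvd_mul_of_dvd_right h4 (2 * t)))
    refine this.trans (dvd_of_eq ?_)
    rw [value]; ring
  refine hp.pow_dvd_of_dvd_mul_left j hdet ?_
  rw [det_mul_apply]
  exact dvd_add (dvd_sub (dvd_mul_of_dvd_left h1 _) (dvd_mul_of_dvd_left h4 _))
    (dvd_mul_of_dvd_left h5 _)

/-- The cross product of two vectors of the lattice of `F` is `p ^ k` times a vector of the
lattice of `G`. -/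
theorem IsDual.exists_cross_eq (h : F.IsDual G κ) (hp : Prime p) (hp2 : 2 < p) (hκ : ¬ p ∣ κ)
    (hdet : ¬ p ∣ G.det) (hv : v ∈ F.lattice p t k) (hw : w ∈ F.lattice p t k) :
    ∃ u ∈ G.lattice p t k, v ⨯₃ w = p ^ k • u := by
  have h2 : ¬ p ∣ 2 := fun hd => absurd (Int.le_of_dvd two_pos hd) (by lia)
  have h2κ : ¬ p ∣ -(2 * κ) := by
    rw [dvd_neg]; exact fun hd => (hp.dvd_or_dvd hd).elim h2 hκ
  have hnκ : ¬ p ∣ -κ := by rwa [dvd_neg]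
  have hpk : p ^ k ≠ 0 := pow_ne_zero _ hp.ne_zero
  obtain ⟨hv1, hv2⟩ := hv
  obtain ⟨hw1, hw2⟩ := hw
  -- The coordinates of `v` and `w` are divisible by `1, p ^ k, p ^ (2k)`, so their minors by `p ^
  -- k, p ^ (2k), p ^ (3k)`: the dual conditions times `p ^ k`.
  have e1 : p ^ k ∣ G.lead ⬝ᵥ v ⨯₃ w := by
    refine hp.pow_dvd_of_dvd_mul_left k hnκ ?_
    rw [← h.lead_slope (t := t)]
    exact dvd_sub (dvd_mul_of_dvd_right hw2 _) (dvd_mul_of_dvd_right hv2 _)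
  have e2 : p ^ (2 * k) ∣ G.slope t (v ⨯₃ w) := by
    refine hp.pow_dvd_of_dvd_mul_left _ h2κ ?_
    rw [← h.lead_value (t := t)]
    exact dvd_sub (dvd_mul_of_dvd_right hw1 _) (dvd_mul_of_dvd_right hv1 _)
  have e3 : p ^ (k + 2 * k) ∣ G.value t (v ⨯₃ w) := by
    refine hp.pow_dvd_of_dvd_mul_left _ hnκ ?_
    rw [← h.slope_value (t := t), pow_add]
    exact dvd_sub (mul_dvd_mul hv2 hw1) (mul_dvd_mul hw2 hv1)
  have e4 := pow_dvd_apply hp hdet e1 ((pow_dvd_pow p (by lia)).trans e2)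
    ((pow_dvd_pow p (by lia)).trans e3)
  choose u hu using e4
  have hu' : v ⨯₃ w = p ^ k • u := by ext i; simp [hu i]
  refine ⟨u, ⟨?_, ?_⟩, hu'⟩
  · rw [hu', value_smul, pow_add] at e3
    exact (mul_dvd_mul_iff_left hpk).1 e3
  · rw [hu', slope_smul, two_mul, pow_add] at e2
    exact (mul_dvd_mul_iff_left hpk).1 e2

/-! ### Descent in the tree of separated vertices. -/

/-- The lattice at `(t, k)` has no nonzero vectors of height less than `p ^ k / (2 p ²)`. -/
def Separated (F : QuadFrame) (p t : ℤ) (k : ℕ) : Prop :=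
  ∀ v ∈ F.lattice p t k, ∀ H : ℤ, InBox H v → 2 * p ^ 2 * H < p ^ k → v = 0

/-- A short vector of the lattice of a child is not divisible by `p`. -/
theorem Separated.not_dvd_lead (hF : F.Separated p t k) (hp : Prime p) (hp2 : 2 < p)
    (hdet : ¬ p ∣ F.det) {s H : ℤ} (hv : v ∈ F.lattice p (t + p ^ k * s) (k + 1))
    (hbox : InBox H v) (hH : 2 * p ^ 2 * H < p ^ (k + 1)) (hv0 : v ≠ 0) : ¬ p ∣ F.lead ⬝ᵥ v := by
  -- Otherwise `p` divides `v`, and `v / p` is a vector of the parent lattice below the parent's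
  -- threshold.
  intro hlead
  apply hv0
  have hp0 : p ≠ 0 := hp.ne_zero
  have hd : ∀ i, p ∣ v i := fun i => by
    have := pow_dvd_apply (j := 1) hp hdet (by simpa using hlead)
      ((pow_dvd_pow p (by lia)).trans hv.2) ((pow_dvd_pow p (by lia)).trans hv.1) i
    simpa using this
  choose u hu using hd
  have hu' : v = p • u := by ext i; simp [hu i]
  have hmem : u ∈ F.lattice p t k := by
    obtain ⟨h1, h2⟩ := hv
    rw [hu', slope_smul, pow_succ', mul_dvd_mul_iff_left hp0] at h2
    rw [hu', value_smul, show 2 * (k + 1) = 2 * k + 1 + 1 by ring, pow_succ',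
      mul_dvd_mul_iff_left hp0] at h1
    have h1' := (pow_dvd_pow p (show 2 * k ≤ 2 * k + 1 by lia)).trans h1
    rw [slope_add] at h2
    have h2' : p ^ k ∣ F.slope t u :=
      (dvd_add_left (dvd_mul_of_dvd_left (dvd_mul_right _ _) _)).1 h2
    refine ⟨?_, h2'⟩
    rw [value_add, add_assoc] at h1'
    refine (dvd_add_left ?_).1 h1'
    obtain ⟨c, hc⟩ := h2'
    exact ⟨2 * s * c + s ^ 2 * (F.lead ⬝ᵥ u), by rw [hc]; ring⟩
  have hu0 : u = 0 := by
    refine hF u hmem (H / p) (fun i => ?_) ?_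
    · rw [Int.le_ediv_iff_mul_le (by lia), mul_comm]
      have := hbox i
      rwa [hu i, abs_mul, abs_of_pos (by lia : 0 < p)] at this
    · have h1 : H / p * p ≤ H := Int.ediv_mul_le _ hp0
      have hpp : 0 < 2 * p ^ 2 := by positivity
      refine lt_of_mul_lt_mul_right (a := p) ?_ (by lia)
      rw [← pow_succ]
      calc 2 * p ^ 2 * (H / p) * p = 2 * p ^ 2 * (H / p * p) := by ring
        _ ≤ 2 * p ^ 2 * H := mul_le_mul_of_nonneg_left h1 hpp.le
        _ < _ := hH
  rw [hu', hu0, smul_zero]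

/-- At most one child of a separated vertex fails to be separated. -/
theorem IsDual.dvd_sub_of_not_separated (h : F.IsDual G κ) (hp : Prime p) (hp2 : 2 < p)
    (hκ : ¬ p ∣ κ) (hdF : ¬ p ∣ F.det) (hdG : ¬ p ∣ G.det) (hF : F.Separated p t k)
    (hG : G.Separated p t k) {s s' : ℤ} (hs : ¬ F.Separated p (t + p ^ k * s) (k + 1))
    (hs' : ¬ F.Separated p (t + p ^ k * s') (k + 1)) : p ∣ s - s' := by
  simp only [Separated, not_forall, exists_prop] at hs hs'
  obtain ⟨v, hv, H, hvH, hH, hv0⟩ := hs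
  obtain ⟨w, hw, K, hwK, hK, hw0⟩ := hs'
  have hlv := hF.not_dvd_lead hp hp2 hdF hv hvH hH hv0
  have hlw := hF.not_dvd_lead hp hp2 hdF hw hwK hK hw0
  have hpk : 0 < p ^ k := pow_pos (by lia) _
  obtain ⟨u, hu, huv⟩ := h.exists_cross_eq hp hp2 hκ hdG (lattice_child_le s hv)
    (lattice_child_le s' hw)
  have hbox := hvH.cross hwK
  have hH0 : 0 ≤ H := (abs_nonneg _).trans (hvH 0)
  have hK0 : 0 ≤ K := (abs_nonneg _).trans (hwK 0)
  have hu0 : u = 0 := by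
    refine hG u hu (2 * (H * K) / p ^ k) (fun i => ?_) ?_
    · rw [Int.le_ediv_iff_mul_le hpk, mul_comm]
      have := hbox i
      rwa [huv, Pi.smul_apply, smul_eq_mul, abs_mul, abs_of_pos hpk] at this
    · have h1 : 2 * (H * K) / p ^ k * p ^ k ≤ 2 * (H * K) := Int.ediv_mul_le _ hpk.ne'
      -- The threshold `T = p ^ k / (2 p ^ 2)` reproduces itself: children allow `p T`, and `2 (p T)
      -- ^ 2 / p ^ k = T`.
      have hmul : (2 * p ^ 2 * H) * (2 * p ^ 2 * K) < p ^ (k + 1) * p ^ (k + 1) :=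
        mul_lt_mul'' hH hK (by positivity) (by positivity)
      have hpp : 0 < p ^ 2 := by positivity
      refine lt_of_mul_lt_mul_right (a := p ^ k) ?_ hpk.le
      refine lt_of_mul_lt_mul_left (a := p ^ 2) ?_ hpp.le
      calc p ^ 2 * (2 * p ^ 2 * (2 * (H * K) / p ^ k) * p ^ k)
          = 2 * p ^ 2 * p ^ 2 * (2 * (H * K) / p ^ k * p ^ k) := by ring
        _ ≤ 2 * p ^ 2 * p ^ 2 * (2 * (H * K)) := mul_le_mul_of_nonneg_left h1 (by positivity)
        _ = (2 * p ^ 2 * H) * (2 * p ^ 2 * K) := by ring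
        _ < _ := hmul
        _ = _ := by ring
  -- For parallel vectors the minor vanishes; since the slope of `v` at `t` is `-p ^ k s` times its
  -- leading coefficient modulo `p ^ (k + 1)`, and likewise for `w` and `s'`, this forces `s ≡ s'`.
  have hls := h.lead_slope (t := t) v w
  rw [huv, hu0, smul_zero, dotProduct_zero, mul_zero, sub_eq_zero] at hls
  obtain ⟨a, ha⟩ := hv.2
  obtain ⟨b, hb⟩ := hw.2
  rw [slope_add] at ha hb
  have hdvd : p ∣ (s - s') * (F.lead ⬝ᵥ v * (F.lead ⬝ᵥ w)) := by
    refine (mul_dvd_mul_iff_left hpk.ne').1 ⟨a * (F.lead ⬝ᵥ w) - b * (F.lead ⬝ᵥ v), ?_⟩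
    linear_combination hls + F.lead ⬝ᵥ w * ha - F.lead ⬝ᵥ v * hb
  exact (hp.dvd_or_dvd hdvd).resolve_right fun hd => (hp.dvd_or_dvd hd).elim hlv hlw

/-- Each predicate fails at most once among `0, 1, 2`, so one of the three survives both. -/
theorem exists_and_of_pairwise_or {A B : ℤ → Prop}
    (hA : ∀ s s' : ℤ, 0 < s - s' → s - s' < 3 → A s ∨ A s')
    (hB : ∀ s s' : ℤ, 0 < s - s' → s - s' < 3 → B s ∨ B s') : ∃ s, A s ∧ B s := by
  have a10 := hA 1 0 (by norm_num) (by norm_num)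
  have a20 := hA 2 0 (by norm_num) (by norm_num)
  have a21 := hA 2 1 (by norm_num) (by norm_num)
  have b10 := hB 1 0 (by norm_num) (by norm_num)
  have b20 := hB 2 0 (by norm_num) (by norm_num)
  have b21 := hB 2 1 (by norm_num) (by norm_num)
  by_contra! hc
  have c0 := hc 0
  have c1 := hc 1
  have c2 := hc 2
  tauto

/-- There are arbitrarily deep vertices at which both lattices are separated. -/
theorem IsDual.exists_separated {κ' : ℤ} (h : F.IsDual G κ) (h' : G.IsDual F κ') (hp : Prime p)
    (hp2 : 2 < p) (hκ : ¬ p ∣ κ) (hκ' : ¬ p ∣ κ') (hdF : ¬ p ∣ F.det) (hdG : ¬ p ∣ G.det) (k : ℕ) :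
    ∃ t : ℤ, p ∣ t ∧ F.Separated p t (k + 1) ∧ G.Separated p t (k + 1) := by
  induction k with
  | zero =>
    -- At depth 1 the threshold is below 1, so only zero qualifies. Starting there with `t = 0`
    -- keeps `p ∣ t` afterwards.
    have key : ∀ F : QuadFrame, F.Separated p 0 (0 + 1) := fun F v _ H hvH hH => by
      have hH1 : H < 1 := by
        by_contra! hc
        rw [zero_add, pow_one] at hH
        nlinarith [mul_le_mul_of_nonneg_left hc (by positivity : 0 ≤ 2 * p ^ 2)]
      ext i
      have := hvH i
      exact abs_eq_zero.1 (by have := abs_nonneg (v i); lia)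
    exact ⟨0, dvd_zero _, key F, key G⟩
  | succ k ih =>
    obtain ⟨t, ht, hF, hG⟩ := ih
    have hsep : ∀ s s' : ℤ, 0 < s - s' → s - s' < 3 → ¬ p ∣ s - s' := fun s s' h1 h2 hd => by
      have := Int.le_of_dvd h1 hd
      lia
    have tF : ∀ s s' : ℤ, 0 < s - s' → s - s' < 3 →
        F.Separated p (t + p ^ (k + 1) * s) (k + 1 + 1) ∨
        F.Separated p (t + p ^ (k + 1) * s') (k + 1 + 1) := fun s s' h1 h2 => by
      by_contra! hc
      exact hsep s s' h1 h2 (h.dvd_sub_of_not_separated hp hp2 hκ hdF hdG hF hG hc.1 hc.2)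
    have tG : ∀ s s' : ℤ, 0 < s - s' → s - s' < 3 →
        G.Separated p (t + p ^ (k + 1) * s) (k + 1 + 1) ∨
        G.Separated p (t + p ^ (k + 1) * s') (k + 1 + 1) := fun s s' h1 h2 => by
      by_contra! hc
      exact hsep s s' h1 h2 (h'.dvd_sub_of_not_separated hp hp2 hκ' hdG hdF hG hF hc.1 hc.2)
    obtain ⟨s, hs⟩ := exists_and_of_pairwise_or tF tG
    exact ⟨t + p ^ (k + 1) * s,
      dvd_add ht (dvd_mul_of_dvd_left (dvd_pow_self p k.succ_ne_zero) s), hs⟩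

/-! ### Counting lattice points and finding short vectors. -/

/-- The lattice has at least as many points in a cube as its index suggests. -/
theorem exists_finset_lattice (F : QuadFrame) (hp : 0 < p) (t : ℤ) (k c : ℕ) :
    ∃ S : Finset (Fin 3 → ℤ), c ^ 3 < S.card ∧
      ∀ v ∈ S, v ∈ F.lattice p t k ∧ InBox (c * p ^ k) v := by
  classical
  obtain ⟨q, rfl⟩ := Int.eq_ofNat_of_zero_le hp.le
  have hq : 0 < q := by exact_mod_cast hp
  set N : ℤ := (q : ℤ) ^ k with hN
  have hNpos : 0 < N := pow_pos hp _
  set box : Finset (Fin 3 → ℤ) := Fintype.piFinset fun _ => Finset.Icc 0 (c * N)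
  set T : Finset (ℤ × ℤ) := Finset.Ico 0 (N ^ 2) ×ˢ Finset.Ico 0 N
  set f : (Fin 3 → ℤ) → ℤ × ℤ := fun v => (F.value t v % N ^ 2, F.slope t v % N)
  have hf : ∀ v ∈ box, f v ∈ T := fun v _ => by
    simp only [f, T, Finset.mem_product, Finset.mem_Ico]
    exact ⟨⟨Int.emod_nonneg _ (by positivity), Int.emod_lt_of_pos _ (by positivity)⟩,
      Int.emod_nonneg _ hNpos.ne', Int.emod_lt_of_pos _ hNpos⟩
  have hT : T.card = (q ^ k) ^ 3 := by
    have h1 : (N ^ 2).toNat = (q ^ k) ^ 2 := by rw [hN]; norm_cast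
    have h2 : N.toNat = q ^ k := by rw [hN]; norm_cast
    simp only [T, Finset.card_product, Int.card_Ico, sub_zero, h1, h2]
    ring
  have hbox : box.card = (c * q ^ k + 1) ^ 3 := by
    have h1 : (c * N + 1).toNat = c * q ^ k + 1 := by rw [hN]; norm_cast
    simp only [box, Fintype.card_piFinset, Int.card_Icc, sub_zero, h1, Finset.prod_const,
      Finset.card_univ, Fintype.card_fin]
  have hlt : T.card * c ^ 3 < box.card := by
    rw [hT, hbox, ← mul_pow, mul_comm (q ^ k)]
    exact Nat.pow_lt_pow_left (Nat.lt_succ_self _) (by norm_num)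
  -- Some residue class is crowded; subtracting one of its members moves it into the lattice.
  obtain ⟨y, -, hy⟩ := Finset.exists_lt_card_fiber_of_mul_lt_card_of_maps_to hf hlt
  obtain ⟨b, hb⟩ := Finset.card_pos.1 (Nat.zero_lt_of_lt hy)
  refine ⟨((box.filter fun x => f x = y).image fun x => x - b), ?_, ?_⟩
  · rwa [Finset.card_image_of_injective _ sub_left_injective]
  · intro v hv
    obtain ⟨x, hx, rfl⟩ := Finset.mem_image.1 hv
    obtain ⟨hxb, hxy⟩ := Finset.mem_filter.1 hx
    obtain ⟨hbb, hby⟩ := Finset.mem_filter.1 hb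
    have hfx := hxy.trans hby.symm
    simp only [f, Prod.mk.injEq] at hfx
    refine ⟨⟨?_, ?_⟩, fun i => ?_⟩
    · have := (Int.ModEq.symm hfx.1).dvd
      rw [hN, ← pow_mul, mul_comm k] at this
      refine this.trans (dvd_of_eq ?_)
      simp only [value, dotProduct_sub]; ring
    · refine (Int.ModEq.symm hfx.2).dvd.trans (dvd_of_eq ?_)
      simp only [slope, dotProduct_sub]; ring
    · have h1 := Finset.mem_Icc.1 (Fintype.mem_piFinset.1 hxb i)
      have h2 := Finset.mem_Icc.1 (Fintype.mem_piFinset.1 hbb i)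
      rw [Pi.sub_apply]
      exact abs_le.2 ⟨by linarith, by linarith⟩

theorem abs_lt_of_ediv_eq {a b N : ℤ} (hN : 0 < N) (h : a / N = b / N) : |a - b| < N := by
  have h1 := Int.emod_add_mul_ediv a N
  have h2 := Int.emod_add_mul_ediv b N
  have h3 := Int.emod_nonneg a hN.ne'
  have h4 := Int.emod_nonneg b hN.ne'
  have h5 := Int.emod_lt_of_pos a hN
  have h6 := Int.emod_lt_of_pos b hN
  rw [h] at h1
  exact abs_lt.2 ⟨by linarith, by linarith⟩

theorem ediv_mem_Icc {a N B : ℤ} (hN : 0 < N) (h : |a| ≤ B * N) :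
    a / N ∈ Finset.Icc (-B) B := by
  obtain ⟨h1, h2⟩ := abs_le.1 h
  rw [Finset.mem_Icc, Int.le_ediv_iff_mul_le hN]
  refine ⟨by linarith, ?_⟩
  have := Int.ediv_le_ediv hN h2
  rwa [Int.mul_ediv_cancel _ hN.ne'] at this

/-- A separated lattice has three linearly independent vectors of height `≪ p ^ k`. -/
theorem IsDual.exists_independent (h : F.IsDual G κ) (hp : Prime p) (hp2 : 2 < p) (hκ : ¬ p ∣ κ)
    (hdG : ¬ p ∣ G.det) (hF : F.Separated p t k) (hG : G.Separated p t k) :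
    ∃ a ∈ F.lattice p t k, ∃ b ∈ F.lattice p t k, ∃ c ∈ F.lattice p t k,
      InBox (45 * p ^ 4 * p ^ k) a ∧ InBox (45 * p ^ 4 * p ^ k) b ∧ InBox (45 * p ^ 4 * p ^ k) c ∧
      a ⬝ᵥ b ⨯₃ c ≠ 0 := by
  have hp0 : 0 < p := by lia
  have hN : 0 < p ^ k := pow_pos hp0 _
  obtain ⟨q, rfl⟩ := Int.eq_ofNat_of_zero_le hp0.le
  have hq : 1 ≤ q := by exact_mod_cast hp0
  have hq4 : (1 : ℤ) ≤ (q : ℤ) ^ 4 := one_le_pow₀ (by exact_mod_cast hq)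
  obtain ⟨S₁, hS₁, hS₁'⟩ := F.exists_finset_lattice hp0 t k 1
  obtain ⟨a, ha, ha0⟩ := Finset.exists_mem_ne (one_pow (M := ℕ) 3 ▸ hS₁) 0
  obtain ⟨hal, hab⟩ := hS₁' a ha
  rw [Nat.cast_one, one_mul] at hab
  obtain ⟨S, hS, hS'⟩ := F.exists_finset_lattice hp0 t k (45 * q ^ 4)
  push_cast at hS'
  suffices hmain : ∃ b ∈ S, ∃ c ∈ S, a ⬝ᵥ b ⨯₃ c ≠ 0 by
    obtain ⟨b, hb, c, hc, hne⟩ := hmain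
    refine ⟨a, hal, b, (hS' b hb).1, c, (hS' c hc).1, fun i => (hab i).trans ?_,
      (hS' b hb).2, (hS' c hc).2, hne⟩
    nlinarith
  by_contra! hcop
  -- The coordinate `i` controls the vectors `a ⨯₃ (u - v)`, which are all parallel.
  obtain ⟨i, hi⟩ : ∃ i, ∀ u ∈ S, ∀ v ∈ S, ∀ j, |(a ⨯₃ (u - v)) j| ≤ |(a ⨯₃ (u - v)) i| := by
    by_cases hz : ∀ u ∈ S, a ⨯₃ u = 0
    · refine ⟨0, fun u hu v hv j => ?_⟩
      simp [map_sub, hz u hu, hz v hv]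
    · push Not at hz
      obtain ⟨w, hw, hw0⟩ := hz
      obtain ⟨i, hi⟩ := exists_forall_abs_le (a ⨯₃ w)
      refine ⟨i, fun u hu v hv j => abs_le_abs_of_cross_eq_zero ?_ hw0 hi j⟩
      have hpar : ∀ u ∈ S, (a ⨯₃ u) ⨯₃ (a ⨯₃ w) = 0 := fun u hu => by
        have : (a ⨯₃ u) ⨯₃ (a ⨯₃ w) = (a ⬝ᵥ u ⨯₃ w) • a := by
          ext l
          fin_cases l <;> simp [cross_apply, dotProduct, Fin.sum_univ_three] <;> ring
        rw [this, hcop u hu w hw, zero_smul]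
      rw [map_sub, map_sub, LinearMap.sub_apply, hpar u hu, hpar v hv, sub_zero]
  obtain ⟨j, hj⟩ := exists_forall_abs_le a
  set N : ℤ := (q : ℤ) ^ k with hNdef
  -- If two points share a cell, their difference is parallel to `a` because the dual lattice is
  -- separated, then zero because this one is.
  set f : (Fin 3 → ℤ) → ℤ × ℤ := fun v => (2 * q ^ 2 * (a ⨯₃ v) i / (N * N), 2 * q ^ 2 * v j / N)
  set B₁ : ℤ := 180 * q ^ 6
  set B₂ : ℤ := 90 * q ^ 6
  have hinj : Set.InjOn f S := by
    intro u hu v hv huv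
    simp only [f, Prod.mk.injEq] at huv
    have h1 := abs_lt_of_ediv_eq (mul_pos hN hN) huv.1
    have h2 := abs_lt_of_ediv_eq hN huv.2
    have hmem := sub_mem (hS' u hu).1 (hS' v hv).1
    obtain ⟨w, hw, hcw⟩ := h.exists_cross_eq hp hp2 hκ hdG hal hmem
    have hq2 : (0 : ℤ) < 2 * q ^ 2 := by positivity
    have hw0 : w = 0 := by
      refine hG w hw |w i| (fun l => ?_) ?_
      · have := hi u hu v hv l
        rw [hcw] at this
        simp only [Pi.smul_apply, smul_eq_mul, abs_mul] at this
        exact le_of_mul_le_mul_left this (abs_pos.2 hN.ne')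
      · rw [← mul_sub, abs_mul, abs_of_pos hq2, ← Pi.sub_apply, ← map_sub, hcw, Pi.smul_apply,
          smul_eq_mul, abs_mul, abs_of_pos hN] at h1
        refine lt_of_mul_lt_mul_right (a := N) ?_ hN.le
        linarith
    have hpar : (u - v) ⨯₃ a = 0 := by
      rw [← cross_anticomm, hcw, hw0, smul_zero, neg_zero]
    refine sub_eq_zero.1 (hF _ hmem |(u - v) j|
      (fun l => abs_le_abs_of_cross_eq_zero hpar ha0 hj l) ?_)
    rwa [← mul_sub, abs_mul, abs_of_pos hq2, ← Pi.sub_apply] at h2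
  have hmaps : Set.MapsTo f S (Finset.Icc (-B₁) B₁ ×ˢ Finset.Icc (-B₂) B₂ : Finset (ℤ × ℤ)) := by
    intro v hv
    have hvb := (hS' v hv).2
    rw [Finset.mem_coe, Finset.mem_product]
    have hq2 : (0 : ℤ) < 2 * q ^ 2 := by positivity
    constructor
    · refine ediv_mem_Icc (mul_pos hN hN) ?_
      rw [abs_mul, abs_of_pos hq2]
      calc 2 * (q : ℤ) ^ 2 * |(a ⨯₃ v) i|
          ≤ 2 * (q : ℤ) ^ 2 * (2 * (N * (45 * q ^ 4 * N))) :=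
            mul_le_mul_of_nonneg_left (hab.cross hvb i) hq2.le
        _ = B₁ * (N * N) := by ring
    · refine ediv_mem_Icc hN ?_
      rw [abs_mul, abs_of_pos hq2]
      calc 2 * (q : ℤ) ^ 2 * |v j| ≤ 2 * (q : ℤ) ^ 2 * (45 * q ^ 4 * N) :=
            mul_le_mul_of_nonneg_left (hvb j) hq2.le
        _ = B₂ * N := by ring
  have hcard := Finset.card_le_card_of_injOn f hmaps hinj
  have e1 : (B₁ + 1 - -B₁).toNat = 360 * q ^ 6 + 1 := by
    rw [show B₁ + 1 - -B₁ = ((360 * q ^ 6 + 1 : ℕ) : ℤ) by simp only [B₁]; push_cast; ring]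
    exact Int.toNat_natCast _
  have e2 : (B₂ + 1 - -B₂).toNat = 180 * q ^ 6 + 1 := by
    rw [show B₂ + 1 - -B₂ = ((180 * q ^ 6 + 1 : ℕ) : ℤ) by simp only [B₂]; push_cast; ring]
    exact Int.toNat_natCast _
  rw [Finset.card_product, Int.card_Icc, Int.card_Icc, e1, e2] at hcard
  have h6 : 1 ≤ q ^ 6 := Nat.one_le_pow _ _ hq
  have : (360 * q ^ 6 + 1) * (180 * q ^ 6 + 1) ≤ (361 * q ^ 6) * (181 * q ^ 6) :=
    Nat.mul_le_mul (by lia) (by lia)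
  -- There are too few cells: `361 * 181 = 65341 < 91125 = 45 ^ 3`.
  have h3 : (45 * q ^ 4) ^ 3 = 91125 * (q ^ 6 * q ^ 6) := by ring
  have h7 : 1 ≤ q ^ 6 * q ^ 6 := Nat.mul_pos h6 h6
  have h8 : (361 * q ^ 6) * (181 * q ^ 6) = 65341 * (q ^ 6 * q ^ 6) := by ring
  lia

/-- Every vector of the lattice is congruent to a vector of height at most `3 H` modulo three
independent vectors of height at most `H`. -/
theorem exists_sub_inBox {a b c : Fin 3 → ℤ} {H : ℤ} (ha : InBox H a) (hb : InBox H b)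
    (hc : InBox H c) (hne : a ⬝ᵥ b ⨯₃ c ≠ 0) (v : Fin 3 → ℤ) :
    ∃ l m n : ℤ, InBox (3 * H) (v - (l • a + m • b + n • c)) := by
  wlog hpos : 0 < a ⬝ᵥ b ⨯₃ c generalizing a
  · have hneg : InBox H (-a) := fun i => by rw [Pi.neg_apply, abs_neg]; exact ha i
    have hpos' : 0 < -a ⬝ᵥ b ⨯₃ c := by
      rw [neg_dotProduct]
      exact neg_pos.2 (lt_of_le_of_ne (not_lt.1 hpos) hne)
    obtain ⟨l, m, n, hlmn⟩ := this hneg hpos'.ne' hpos'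
    exact ⟨-l, m, n, by simpa using hlmn⟩
  set D := a ⬝ᵥ b ⨯₃ c
  set x := v ⬝ᵥ b ⨯₃ c
  set y := a ⬝ᵥ v ⨯₃ c
  set z := a ⬝ᵥ b ⨯₃ v
  -- Cramer's coefficients rounded down: each remainder costs at most `H`.
  refine ⟨x / D, y / D, z / D, fun i => ?_⟩
  have hcramer : D * v i = x * a i + y * b i + z * c i := by
    fin_cases i <;> simp [D, x, y, z, cross_apply, dotProduct, Fin.sum_univ_three] <;> ring
  have hkey : D * (v - ((x / D) • a + (y / D) • b + (z / D) • c)) i =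
      x % D * a i + y % D * b i + z % D * c i := by
    have h1 := Int.emod_add_mul_ediv x D
    have h2 := Int.emod_add_mul_ediv y D
    have h3 := Int.emod_add_mul_ediv z D
    simp only [Pi.sub_apply, Pi.add_apply, Pi.smul_apply, smul_eq_mul]
    linear_combination hcramer - a i * h1 - b i * h2 - c i * h3
  have hterm : ∀ (r u : ℤ), |u| ≤ H → |r % D * u| ≤ D * H := fun r u hu => by
    rw [abs_mul, abs_of_nonneg (Int.emod_nonneg _ hpos.ne')]
    exact mul_le_mul (Int.emod_lt_of_pos _ hpos).le hu (abs_nonneg _) hpos.le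
  refine le_of_mul_le_mul_left ?_ hpos
  rw [← abs_of_pos hpos, ← abs_mul, abs_of_pos hpos, hkey]
  have h1 := hterm x _ (ha i)
  have h2 := hterm y _ (hb i)
  have h3 := hterm z _ (hc i)
  exact (abs_add_three _ _ _).trans (by linarith)

/-- A separated lattice contains a short vector whose leading coefficient is prime to `p`. -/
theorem IsDual.exists_short (h : F.IsDual G κ) (hp : Prime p) (hp2 : 2 < p) (hκ : ¬ p ∣ κ)
    (hdF : ¬ p ∣ F.det) (hdG : ¬ p ∣ G.det) (hF : F.Separated p t k) (hG : G.Separated p t k) :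
    ∃ v ∈ F.lattice p t k, InBox (135 * p ^ 4 * p ^ k) v ∧ ¬ p ∣ F.lead ⬝ᵥ v := by
  obtain ⟨a, ha, b, hb, c, hc, hab, hbb, hcb, hne⟩ :=
    h.exists_independent hp hp2 hκ hdG hF hG
  set H : ℤ := 45 * p ^ 4 * p ^ k with hHdef
  have hH : 135 * p ^ 4 * p ^ k = 3 * H := by rw [hHdef]; ring
  have hH0 : 0 ≤ H := (abs_nonneg _).trans (hab 0)
  have hmono : ∀ v, InBox H v → InBox (3 * H) v := fun v hv i => (hv i).trans (by lia)
  rw [hH]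
  by_contra! hcon
  have hla := hcon a ha (hmono a hab)
  have hlb := hcon b hb (hmono b hbb)
  have hlc := hcon c hc (hmono c hcb)
  -- The polynomial of this vector is `det · (T - t)²`. If every short vector had leading
  -- coefficient divisible by `p`, reducing `v` would give `p ∣ det`.
  set v : Fin 3 → ℤ := F.mid ⨯₃ F.const + t • (F.lead ⨯₃ F.const) +
    t ^ 2 • (F.lead ⨯₃ F.mid) with hv
  have hlead : F.lead ⬝ᵥ v = F.det := by
    simp [hv, det, cross_apply, dotProduct, Fin.sum_univ_three]; ring
  have hvm : v ∈ F.lattice p t k := by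
    have e1 : F.value t v = 0 := by
      simp [hv, value, cross_apply, dotProduct, Fin.sum_univ_three]; ring
    have e2 : F.slope t v = 0 := by
      simp [hv, slope, cross_apply, dotProduct, Fin.sum_univ_three]; ring
    exact ⟨e1 ▸ dvd_zero _, e2 ▸ dvd_zero _⟩
  obtain ⟨l, m, n, hbox⟩ := exists_sub_inBox hab hbb hcb hne v
  have hsum : l • a + m • b + n • c ∈ F.lattice p t k :=
    add_mem (add_mem (zsmul_mem ha _) (zsmul_mem hb _)) (zsmul_mem hc _)
  have hlv := hcon _ (sub_mem hvm hsum) hbox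
  rw [dotProduct_sub, hlead, dotProduct_add, dotProduct_add, dotProduct_smul, dotProduct_smul,
    dotProduct_smul] at hlv
  refine hdF ((dvd_sub_left ?_).1 hlv)
  exact dvd_add (dvd_add (dvd_mul_of_dvd_right hla _) (dvd_mul_of_dvd_right hlb _))
    (dvd_mul_of_dvd_right hlc _)

end QuadFrame

/-! ### The frame of a diagonal form. -/

namespace QuadFrame

/-- The frame of the form `-(b e² + c f²) x² + b y² + c z²`, which attaches to `v` its scalar
products with the isotropic vectors `(1, e, f) + 2 t (0, c f, -b e) - b c t² (-1, e, f)`. -/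
def diagonal (b c e f : ℤ) : QuadFrame where
  lead := ![-(b * c) * (b * e ^ 2 + c * f ^ 2), -(b * c) * (b * e), -(b * c) * (c * f)]
  mid := ![0, b * c * f, -(b * c * e)]
  const := ![-(b * e ^ 2 + c * f ^ 2), b * e, c * f]

/-- The frame which attaches to `v` its dot products with the isotropic vectors
`(1, e, f) + 2 t (0, c f, -b e) - b c t² (-1, e, f)`. -/
def diagonalDual (b c e f : ℤ) : QuadFrame where
  lead := ![b * c, -(b * c * e), -(b * c * f)]
  mid := ![0, c * f, -(b * e)]
  const := ![1, e, f]

variable (b c e f : ℤ)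

theorem diagonal_isDual :
    (diagonal b c e f).IsDual (diagonalDual b c e f) (-((b * e ^ 2 + c * f ^ 2) * b * c)) := by
  constructor <;> ext i <;> fin_cases i <;> simp [diagonal, diagonalDual, cross_apply] <;>
    first | exact Or.inl (by ring) | ring

theorem diagonalDual_isDual : (diagonalDual b c e f).IsDual (diagonal b c e f) 1 := by
  constructor <;> ext i <;> fin_cases i <;> simp [diagonal, diagonalDual, cross_apply] <;> ring

theorem det_diagonal :
    (diagonal b c e f).det = -(2 * (b * c * (b * e ^ 2 + c * f ^ 2)) ^ 2) := by
  simp [diagonal, det, cross_apply, dotProduct, Fin.sum_univ_three]; ring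

theorem det_diagonalDual :
    (diagonalDual b c e f).det = 2 * (b * c * (b * e ^ 2 + c * f ^ 2)) := by
  simp [diagonalDual, det, cross_apply, dotProduct, Fin.sum_univ_three]; ring

variable {b c e f}

/-- The discriminant does not change when the polynomial is recentred at `t`; this turns lattice
membership into the congruence. -/
theorem slope_sq_sub (t : ℤ) (v : Fin 3 → ℤ) :
    (diagonal b c e f).slope t v ^ 2 -
      (diagonal b c e f).lead ⬝ᵥ v * (diagonal b c e f).value t v =
    b * c * (b * e ^ 2 + c * f ^ 2) *
      (-(b * e ^ 2 + c * f ^ 2) * v 0 ^ 2 + b * v 1 ^ 2 + c * v 2 ^ 2) := by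
  simp [diagonal, slope, value, dotProduct, Fin.sum_univ_three]; ring

/-- A lattice vector with leading coefficient prime to `p` is proportional to `(1, e, f)`
modulo `p`. -/
theorem not_dvd_apply {p t : ℤ} {k : ℕ} (hp : Prime p) (hb : ¬ p ∣ b)
    (hc : ¬ p ∣ c) (he : ¬ p ∣ e) (hf : ¬ p ∣ f) (hd : ¬ p ∣ b * e ^ 2 + c * f ^ 2) (ht : p ∣ t)
    {v : Fin 3 → ℤ} (hv : v ∈ (diagonal b c e f).lattice p t (k + 1))
    (hlead : ¬ p ∣ (diagonal b c e f).lead ⬝ᵥ v) : ¬ p ∣ v 0 * v 1 * v 2 := by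
  have hslope : p ∣ (diagonal b c e f).slope t v := (dvd_pow_self p k.succ_ne_zero).trans hv.2
  have hvalue : p ∣ (diagonal b c e f).value t v := (dvd_pow_self p (by lia)).trans hv.1
  -- As `p ∣ t`, modulo `p` the slope is the `mid` form and the value the `const` form.
  have hmid : p ∣ f * v 1 - e * v 2 := by
    rw [slope, dvd_add_right (dvd_mul_of_dvd_right ht _)] at hslope
    have h1 : (diagonal b c e f).mid ⬝ᵥ v = b * c * (f * v 1 - e * v 2) := by
      simp [diagonal, dotProduct, Fin.sum_univ_three]; ring
    rw [h1] at hslope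
    exact (hp.dvd_or_dvd hslope).resolve_left fun h => (hp.dvd_or_dvd h).elim hb hc
  have hconst : p ∣ -(b * e ^ 2 + c * f ^ 2) * v 0 + (b * e * v 1 + c * f * v 2) := by
    rw [value, dvd_add_right (dvd_add (dvd_mul_of_dvd_right (dvd_pow ht two_ne_zero) _)
      (dvd_mul_of_dvd_right ht _))] at hvalue
    refine hvalue.trans (dvd_of_eq ?_)
    simp [diagonal, dotProduct, Fin.sum_univ_three]; ring
  have hlead' : ¬ p ∣ (b * e ^ 2 + c * f ^ 2) * v 0 + (b * e * v 1 + c * f * v 2) := fun h => by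
    refine hlead ((dvd_mul_of_dvd_right h (-(b * c))).trans (dvd_of_eq ?_))
    simp [diagonal, dotProduct, Fin.sum_univ_three]; ring
  have h0 : ¬ p ∣ v 0 := fun h => by
    refine hlead' ((dvd_add hconst (dvd_mul_of_dvd_right h (2 * (b * e ^ 2 + c * f ^ 2)))).trans
      (dvd_of_eq ?_))
    ring
  have h12 : p ∣ v 1 → ¬ p ∣ v 2 := fun h1 h2 => by
    rw [dvd_add_left (dvd_add (dvd_mul_of_dvd_right h1 _) (dvd_mul_of_dvd_right h2 _)),
      neg_mul, dvd_neg] at hconst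
    exact (hp.dvd_or_dvd hconst).elim hd h0
  have h1 : ¬ p ∣ v 1 := fun h1 => by
    rw [dvd_sub_right (dvd_mul_of_dvd_right h1 _)] at hmid
    exact h12 h1 ((hp.dvd_or_dvd hmid).resolve_left he)
  have h2 : ¬ p ∣ v 2 := fun h2 => by
    rw [dvd_sub_left (dvd_mul_of_dvd_right h2 _)] at hmid
    exact h1 ((hp.dvd_or_dvd hmid).resolve_left hf)
  intro h
  rcases hp.dvd_or_dvd h with h | h
  · exact (hp.dvd_or_dvd h).elim h0 h1
  · exact h2 h

end QuadFrame

/-! ### Small solutions and the final bounds. -/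

open QuadFrame in
/-- A diagonal ternary congruence modulo `p ^ n` which has a solution with coordinates prime to
`p` has such a solution of height `≪ p ^ (n / 2)`. -/
theorem exists_small_solution {p : ℤ} (hp : Prime p) (hp2 : 2 < p) {n : ℕ} (hn : n ≠ 0)
    {a b c x y z : ℤ} (ha : ¬ p ∣ a) (hb : ¬ p ∣ b) (hc : ¬ p ∣ c) (hx : ¬ p ∣ x) (hy : ¬ p ∣ y)
    (hz : ¬ p ∣ z) (h : p ^ n ∣ a * x ^ 2 + b * y ^ 2 + c * z ^ 2) :
    ∃ v : Fin 3 → ℤ, p ^ n ∣ a * v 0 ^ 2 + b * v 1 ^ 2 + c * v 2 ^ 2 ∧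
      ¬ p ∣ v 0 * v 1 * v 2 ∧ InBox (135 * p ^ 5 * p ^ (n / 2)) v := by
  have h2 : ¬ p ∣ 2 := fun hd => absurd (Int.le_of_dvd two_pos hd) (by lia)
  obtain ⟨u, w, huw⟩ : IsCoprime x (p ^ n) :=
    (((Prime.coprime_iff_not_dvd hp).2 hx).symm).pow_right
  have hpn : p ∣ p ^ n := dvd_pow_self p hn
  have hu : ¬ p ∣ u := fun hd => hp.not_isUnit (isUnit_of_dvd_one (by
    rw [← huw]
    exact dvd_add (dvd_mul_of_dvd_left hd _) (dvd_mul_of_dvd_right hpn _)))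
  set e := u * y
  set f := u * z
  have he : ¬ p ∣ e := fun hd => (hp.dvd_or_dvd hd).elim hu hy
  have hf : ¬ p ∣ f := fun hd => (hp.dvd_or_dvd hd).elim hu hz
  -- Multiply the solution by `u ^ 2`, using `1 - u² x² = w p ^ n (1 + u x)`.
  have hcong : p ^ n ∣ a + (b * e ^ 2 + c * f ^ 2) := by
    refine (dvd_add (dvd_mul_of_dvd_right h (u ^ 2))
      (dvd_mul_right (p ^ n) (a * w * (1 + u * x)))).trans (dvd_of_eq ?_)
    simp only [e, f]
    linear_combination a * (1 + u * x) * huw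
  have hd : ¬ p ∣ b * e ^ 2 + c * f ^ 2 := fun hd => ha ((dvd_add_left hd).1 (hpn.trans hcong))
  have hbcd : ¬ p ∣ b * c * (b * e ^ 2 + c * f ^ 2) := fun h =>
    (hp.dvd_or_dvd h).elim (fun h => (hp.dvd_or_dvd h).elim hb hc) hd
  have hdF : ¬ p ∣ (diagonal b c e f).det := by
    rw [det_diagonal, dvd_neg]
    exact fun h => (hp.dvd_or_dvd h).elim h2 fun h => hbcd (hp.dvd_of_dvd_pow h)
  have hdG : ¬ p ∣ (diagonalDual b c e f).det := by
    rw [det_diagonalDual]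
    exact fun h => (hp.dvd_or_dvd h).elim h2 hbcd
  have hκ : ¬ p ∣ -((b * e ^ 2 + c * f ^ 2) * b * c) := by
    rw [dvd_neg, mul_assoc, mul_comm]; exact hbcd
  have hκ' : ¬ p ∣ 1 := fun h => hp.not_isUnit (isUnit_of_dvd_one h)
  have hF := diagonal_isDual b c e f
  -- Depth `n / 2 + 1` gives `2 (n / 2 + 1) ≥ n` for odd `n` too, at the cost of a fifth factor `p`.
  obtain ⟨t, ht, hsF, hsG⟩ :=
    hF.exists_separated (diagonalDual_isDual b c e f) hp hp2 hκ hκ' hdF hdG (n / 2)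
  obtain ⟨v, hv, hbox, hlead⟩ := hF.exists_short hp hp2 hκ hdF hdG hsF hsG
  refine ⟨v, ?_, not_dvd_apply hp hb hc he hf hd ht hv hlead, fun i => (hbox i).trans_eq ?_⟩
  · have h1 : p ^ (2 * (n / 2 + 1)) ∣ b * c * (b * e ^ 2 + c * f ^ 2) *
        (-(b * e ^ 2 + c * f ^ 2) * v 0 ^ 2 + b * v 1 ^ 2 + c * v 2 ^ 2) := by
      rw [← slope_sq_sub t v]
      refine dvd_sub ?_ (dvd_mul_of_dvd_right hv.1 _)
      rw [mul_comm, pow_mul]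
      exact pow_dvd_pow_of_dvd hv.2 2
    have h3 := (pow_dvd_pow p (show n ≤ 2 * (n / 2 + 1) by lia)).trans
      (hp.pow_dvd_of_dvd_mul_left _ hbcd h1)
    refine (dvd_add h3 (dvd_mul_of_dvd_left hcong (v 0 ^ 2))).trans (dvd_of_eq ?_)
    ring
  · ring

/-- The smallest solution has height `≪ (p ^ n) ^ (1 / 2)`, uniformly in the coefficients. -/
theorem minHeight_le {p : ℕ} (hp : p.Prime) (hp2 : 2 < p) (n : ℕ) {α₁ α₂ α₃ : ℤ}
    (h : IsCoprime (α₁ * α₂ * α₃) (p : ℤ)) :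
    minHeight p n α₁ α₂ α₃ ≤ 135 * p ^ 5 * p ^ (n / 2) := by
  have hp' : Prime (p : ℤ) := Nat.prime_iff_prime_int.1 hp
  have hbound : 1 ≤ 135 * p ^ 5 * p ^ (n / 2) := by
    have := hp.pos
    exact Nat.succ_le_of_lt (by positivity)
  rcases (solutionHeights p n α₁ α₂ α₃).eq_empty_or_nonempty with hempty | hne
  · rw [minHeight_eq_zero hempty]; exact Nat.zero_le _
  rcases eq_or_ne n 0 with rfl | hn
  -- Modulo `1` every triple prime to `p` is a solution.
  · refine (Nat.sInf_le ⟨1, 1, 1, ?_, ?_, ?_⟩ : minHeight p 0 α₁ α₂ α₃ ≤ 1).trans hbound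
    · rw [pow_zero]; exact Int.modEq_one
    · exact fun hd => hp'.not_isUnit (isUnit_of_dvd_one (by simpa using hd))
    · rfl
  obtain ⟨M, x, y, z, hcong, hxyz, -⟩ := hne
  have hα : ¬ (p : ℤ) ∣ α₁ * α₂ * α₃ := fun hd =>
    hp'.not_isUnit (h.symm.isUnit_of_dvd hd)
  obtain ⟨v, hv, hvu, hbox⟩ := exists_small_solution hp' (by exact_mod_cast hp2) hn
    (fun h => hα (dvd_mul_of_dvd_left (dvd_mul_of_dvd_left h _) _))
    (fun h => hα (dvd_mul_of_dvd_left (dvd_mul_of_dvd_right h _) _))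
    (fun h => hα (dvd_mul_of_dvd_right h _))
    (fun h => hxyz (dvd_mul_of_dvd_left (dvd_mul_of_dvd_left h _) _))
    (fun h => hxyz (dvd_mul_of_dvd_left (dvd_mul_of_dvd_right h _) _))
    (fun h => hxyz (dvd_mul_of_dvd_right h _)) (Int.modEq_zero_iff_dvd.1 hcong)
  have hnat : ∀ i, (v i).natAbs ≤ 135 * p ^ 5 * p ^ (n / 2) := fun i => by
    have := hbox i
    rw [Int.abs_eq_natAbs] at this
    exact_mod_cast this
  have hmem : max (v 0).natAbs (max (v 1).natAbs (v 2).natAbs) ∈ solutionHeights p n α₁ α₂ α₃ :=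
    ⟨v 0, v 1, v 2, Int.modEq_zero_iff_dvd.2 hv, hvu, rfl⟩
  exact (Nat.sInf_le hmem).trans (max_le (hnat 0) (max_le (hnat 1) (hnat 2)))

/-- The uniform bound with an arbitrary larger exponent. -/
theorem minHeight_le_rpow {p : ℕ} (hp : p.Prime) (hp2 : 2 < p) (n : ℕ) {α₁ α₂ α₃ : ℤ}
    (h : IsCoprime (α₁ * α₂ * α₃) (p : ℤ)) {θ : ℝ} (hθ : 1 / 2 ≤ θ) :
    (minHeight p n α₁ α₂ α₃ : ℝ) ≤ 135 * (p : ℝ) ^ 5 * ((p : ℝ) ^ n) ^ θ := by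
  have hp1 : (1 : ℝ) ≤ p := by exact_mod_cast hp.one_le
  have hpow : (p : ℝ) ^ (n / 2) ≤ ((p : ℝ) ^ n) ^ θ := by
    rw [← Real.rpow_natCast, ← Real.rpow_natCast, ← Real.rpow_mul (by positivity)]
    refine Real.rpow_le_rpow_of_exponent_le hp1 (Nat.cast_div_le.trans ?_)
    rw [Nat.cast_ofNat, div_eq_mul_one_div]
    exact mul_le_mul_of_nonneg_left hθ (Nat.cast_nonneg n)
  calc (minHeight p n α₁ α₂ α₃ : ℝ) ≤ 135 * (p : ℝ) ^ 5 * (p : ℝ) ^ (n / 2) := by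
        exact_mod_cast minHeight_le hp hp2 n h
    _ ≤ _ := mul_le_mul_of_nonneg_left hpow (by positivity)

theorem corollary3 (p : ℕ) (hp : p.Prime) (hp2 : 2 < p) (ε : ℝ) (hε : 0 < ε) :
    (∀ α₁ α₂ α₃ : ℤ, IsCoprime (α₁ * α₂ * α₃) (p : ℤ) →
      ∃ C : ℝ, 0 < C ∧ ∀ n : ℕ,
        (minHeight p n α₁ α₂ α₃ : ℝ) ≤ C * ((p : ℝ) ^ n) ^ ((1 : ℝ) / 2 + ε)) ∧
    (∃ C : ℝ, 0 < C ∧ ∀ n : ℕ, ∀ α₁ α₂ α₃ : ℤ, IsCoprime (α₁ * α₂ * α₃) (p : ℤ) →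
        (minHeight p n α₁ α₂ α₃ : ℝ) ≤ C * ((p : ℝ) ^ n) ^ ((11 : ℝ) / 18 + ε)) := by
  have hp0 : (0 : ℝ) < p := by exact_mod_cast hp.pos
  have hC : (0 : ℝ) < 135 * (p : ℝ) ^ 5 := by positivity
  exact ⟨fun _ _ _ h => ⟨_, hC, fun n => minHeight_le_rpow hp hp2 n h (by linarith)⟩,
    _, hC, fun n _ _ _ h => minHeight_le_rpow hp hp2 n h (by linarith)⟩
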